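/- **Theorem 5.4 (Convergence Properties).** Let $b\in\mathbb R^k$, $C\in\mathbb R^{k\times l}$, $c\in\mathbb R^l$, $B\in\mathbb R^{k\times n}$, $A\in\mathbb R^{n\times p}$, $a\in\mathbb R^p$, $M\in\mathbb R^{k\times k}$, with $M$ symmetric positive semidefinite and $B$ injective, and consider $$\min_{y\in\mathbb R^n}\ \rho(y)\quad\text{s.t. } A^Ty\le a,\qquad \rho(y):=\sup_{C^Tu\le c}\bigl\{\langle u,b+By\rangle-\tfrac12\langle u,Mu\rangle\bigr\}\in[-\infty,\infty].\tag{P}$$ Let $N=2l+2p+k+n$, write $\chi=(q,w,u,y,s,r)\in\mathbb R^l\times\mathbb R^p\times\mathbb R^k\times\mathbb R^n\times\mathbb R^l\times\mathbb R^p=\mathbb R^N$, and call $\chi$ *nonnegative* (*positive*) if every component of $q,w,s,r$ is $\ge0$ ($>0$). Consider the linear equations $$s=c-C^Tu,\qquad r=a-A^Ty,\qquad Mu+Cq-By-b=0,\qquad B^Tu+Aw=0.\tag{E}$$ A *KKT point* for (P) is a nonnegative $\chi$ that satisfies (E) and $q^Ts+w^Tr=0$. For $\mu\ge0$ let $F_\mu:\mathbb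 R^N\to\mathbb R^N$, $$F_\mu(\chi)=\bigl(C^Tu+s-c,\ A^Ty+r-a,\ Mu+Cq-By-b,\ B^Tu+Aw,\ (q_is_i-\mu)_i,\ (w_jr_j-\mu)_j\bigr),$$ and let $F^{(1)}_\mu$ be its derivative. A *point of the central path with parameter* $\mu>0$ is a nonnegative $\chi$ with $F_\mu(\chi)=0$. For $\tau\in[0,\infty]$ put $$\mathcal F_+(\tau)=\{\chi \text{ positive}:\ \text{(E) holds},\ q^Ts+w^Tr\le\tau\},\qquad \mathcal F(\tau)=\{\chi \text{ nonnegative}:\ \text{(E) holds},\ q^Ts+w^Tr\le\tau\}.$$ *Interior point method.* Inputs: a positive $\chi^0$, $\mu^0\ge0$, and $\gamma,\eta\in(0,1)$. For $\nu=0,1,2,\dots$: find $d^\nu$ with $F_{\mu^\nu}^{(1)}(\chi^\nu)\,d^\nu=-F_{\mu^\nu}(\chi^\nu)$; let $t_\nu$ be the largest number of the form $\gamma^i$, $i\in\{0,1,2,\dots\}$, such that $\chi^\nu+t_\nu d^\nu$ is positive and $\|F_{\mu^\nu}(\chi^\nu+t_\nu d^\nu)\|\le(1-\eta t_\nu)\|F_{\mu^\nu}(\chi^\nu)\|$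 (Euclidean norm); set $\chi^{\nu+1}=\chi^\nu+t_\nu d^\nu$ and $\mu^{\nu+1}=\frac1{p+l}\bigl((s^{\nu+1})^Tq^{\nu+1}+(r^{\nu+1})^Tw^{\nu+1}\bigr)$ (with $\mu^{\nu+1}=0$ in the degenerate case $p+l=0$). Assume that $\mathcal F_+(\infty)\neq\emptyset$ and $\operatorname{Null}(M)\cap\operatorname{Null}(B^T)\cap\operatorname{Null}(C^T)=\{0\}$. Then: 1. The method is implementable: $F^{(1)}_\mu(\chi)$ is invertible for all $\mu\ge0$ and all positive $\chi$, and from every admissible input the method generates an infinite sequence $(\chi^\nu,\mu^\nu,d^\nu,t_\nu)_{\nu\ge0}$, which is uniquely determined. 2. For every real $\tau\ge0$ the set $\mathcal F(\tau)$ is nonempty, convex and compact. For every real $\tau>0$ the set $\mathcal F_+(\tau)$ is nonempty and convex, and its closure is $\mathcal F(\tau)$. 3. The central path is well defined: for every $\mu>0$ there is exactly one point $\chi(\mu)$ of the central path with parameter $\mu$. 4. Every cluster point $\chi=(q,w,u,y,s,r)$ of $\chi(\mu)$ as $\mu\downarrow0$ is a KKT point for (P); in particular its component $y$ is a global minimizer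 of (P). -/

import Mathlib

open scoped Matrix
open Filter Topology

noncomputable section

/-- The data of a problem `min ρ(c, C, b, B, M; y)  s.t.  Aᵀ y ≤ a`, where `ρ` is a piecewise linear
quadratic function: `M` is symmetric positive semidefinite and `B` is injective. -/
structure PLQProblem (l p k n : ℕ) where
  c : Fin l → ℝ
  C : Matrix (Fin k) (Fin l) ℝ
  b : Fin k → ℝ
  B : Matrix (Fin k) (Fin n) ℝ
  M : Matrix (Fin k) (Fin k) ℝ
  A : Matrix (Fin n) (Fin p) ℝ
  a : Fin p → ℝ
  posSemidef_M : M.PosSemidef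
  injective_B : Function.Injective B.mulVec

/-- The space `ℝ^N`, `N = 2l + 2p + k + n`, with its Euclidean norm; the blocks of coordinates are
`(q, w, u, y, s, r)`, in this order. -/
abbrev PLQVar (l p k n : ℕ) : Type :=
  EuclideanSpace ℝ (Fin l ⊕ Fin p ⊕ Fin k ⊕ Fin n ⊕ Fin l ⊕ Fin p)

namespace PLQVar

variable {l p k n : ℕ}

/-- Assemble a vector of `ℝ^N` from its six blocks. -/
def mk (q : Fin l → ℝ) (w : Fin p → ℝ) (u : Fin k → ℝ) (y : Fin n → ℝ)
    (s : Fin l → ℝ) (r : Fin p → ℝ) : PLQVar l p k n :=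
  WithLp.toLp 2 (Sum.elim q (Sum.elim w (Sum.elim u (Sum.elim y (Sum.elim s r)))))

/-- Multipliers of the constraints `Cᵀ u ≤ c`. -/
def q (χ : PLQVar l p k n) : Fin l → ℝ := fun i => χ (.inl i)

/-- Multipliers of the constraints `Aᵀ y ≤ a`. -/
def w (χ : PLQVar l p k n) : Fin p → ℝ := fun i => χ (.inr (.inl i))

/-- The variable of the supremum that defines `ρ`. -/
def u (χ : PLQVar l p k n) : Fin k → ℝ := fun i => χ (.inr (.inr (.inl i)))

/-- The decision variable. -/
def y (χ : PLQVar l p k n) : Fin n → ℝ := fun i => χ (.inr (.inr (.inr (.inl i))))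

/-- Slacks of the constraints `Cᵀ u ≤ c`. -/
def s (χ : PLQVar l p k n) : Fin l → ℝ := fun i => χ (.inr (.inr (.inr (.inr (.inl i)))))

/-- Slacks of the constraints `Aᵀ y ≤ a`. -/
def r (χ : PLQVar l p k n) : Fin p → ℝ := fun i => χ (.inr (.inr (.inr (.inr (.inr i)))))

/-- `q, w, s, r` are nonnegative in every coordinate. -/
def Nonneg (χ : PLQVar l p k n) : Prop :=
  (∀ i, 0 ≤ χ.q i) ∧ (∀ i, 0 ≤ χ.w i) ∧ (∀ i, 0 ≤ χ.s i) ∧ (∀ i, 0 ≤ χ.r i)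

/-- `q, w, s, r` are positive in every coordinate, that is, `(q, w, s, r) ∈ 𝒟₊₊`. -/
def Pos (χ : PLQVar l p k n) : Prop :=
  (∀ i, 0 < χ.q i) ∧ (∀ i, 0 < χ.w i) ∧ (∀ i, 0 < χ.s i) ∧ (∀ i, 0 < χ.r i)

/-- The complementarity gap `qᵀ s + wᵀ r`. -/
def gap (χ : PLQVar l p k n) : ℝ := χ.q ⬝ᵥ χ.s + χ.w ⬝ᵥ χ.r

end PLQVar

/-- What the interior point method holds at one iteration: the iterate `χ`, the relaxation
parameter `μ`, the Newton direction `d` and the step length `t`. -/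
structure PLQIteration (l p k n : ℕ) where
  χ : PLQVar l p k n
  μ : ℝ
  d : PLQVar l p k n
  t : ℝ

namespace PLQProblem

variable {l p k n : ℕ} (P : PLQProblem l p k n)

/-- The polyhedron `U = {u | Cᵀ u ≤ c}`. -/
def U : Set (Fin k → ℝ) := {u | ∀ i, (P.Cᵀ *ᵥ u) i ≤ P.c i}

/-- The polyhedron `Y = {y | Aᵀ y ≤ a}` of admissible points. -/
def Y : Set (Fin n → ℝ) := {y | ∀ i, (P.Aᵀ *ᵥ y) i ≤ P.a i}

/-- The objective `ρ(y) = sup_{u ∈ U} (⟨u, b + B y⟩ - ½ ⟨u, M u⟩)`, with values in `[-∞, ∞]`. -/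
def ρ (y : Fin n → ℝ) : EReal :=
  ⨆ u ∈ P.U, ((u ⬝ᵥ (P.b + P.B *ᵥ y) - (1 / 2) * (u ⬝ᵥ (P.M *ᵥ u)) : ℝ) : EReal)

/-- `y` is a global minimizer of `ρ` over `Y`. -/
def IsSolution (y : Fin n → ℝ) : Prop := y ∈ P.Y ∧ IsMinOn P.ρ P.Y y

/-- The condition `Null(M) ∩ Null(Bᵀ) ∩ Null(Cᵀ) = {0}`. -/
def NullCondition : Prop :=
  LinearMap.ker P.M.mulVecLin ⊓ LinearMap.ker P.Bᵀ.mulVecLin ⊓ LinearMap.ker P.Cᵀ.mulVecLin = ⊥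

/-- The linear equations of the KKT system. -/
def LinearEqs (χ : PLQVar l p k n) : Prop :=
  χ.s = P.c - P.Cᵀ *ᵥ χ.u ∧
  χ.r = P.a - P.Aᵀ *ᵥ χ.y ∧
  P.M *ᵥ χ.u + P.C *ᵥ χ.q - P.B *ᵥ χ.y - P.b = 0 ∧
  P.Bᵀ *ᵥ χ.u + P.A *ᵥ χ.w = 0

/-- `χ` is a KKT point: a solution of the mixed linear complementarity problem. -/
def IsKKT (χ : PLQVar l p k n) : Prop :=
  P.LinearEqs χ ∧ χ.Nonneg ∧ χ.gap = 0

/-- The relaxed KKT map `F_μ : ℝ^N → ℝ^N`. -/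
def F (μ : ℝ) (χ : PLQVar l p k n) : PLQVar l p k n :=
  PLQVar.mk
    (P.Cᵀ *ᵥ χ.u + χ.s - P.c)
    (P.Aᵀ *ᵥ χ.y + χ.r - P.a)
    (P.M *ᵥ χ.u + P.C *ᵥ χ.q - P.B *ᵥ χ.y - P.b)
    (P.Bᵀ *ᵥ χ.u + P.A *ᵥ χ.w)
    (fun i => χ.q i * χ.s i - μ)
    (fun i => χ.w i * χ.r i - μ)

/-- `𝓕₊(τ)`: the strictly feasible points whose gap is at most `τ`; `τ = ⊤` imposes no bound. -/
def strictFeasible (τ : EReal) : Set (PLQVar l p k n) :=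
  {χ | χ.Pos ∧ P.LinearEqs χ ∧ (χ.gap : EReal) ≤ τ}

/-- `𝓕(τ)`: the feasible points whose gap is at most `τ`. -/
def feasible (τ : EReal) : Set (PLQVar l p k n) :=
  {χ | χ.Nonneg ∧ P.LinearEqs χ ∧ (χ.gap : EReal) ≤ τ}

/-- `χ` is a point of the central path with parameter `μ`. -/
def IsCentral (μ : ℝ) (χ : PLQVar l p k n) : Prop := P.F μ χ = 0 ∧ χ.Nonneg

/-- The step lengths `γ ^ i`, `i = 0, 1, 2, …`, that the line search accepts from `χ` in direction
`d`: the new point is positive and `‖F_μ‖` has decreased sufficiently. -/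
def acceptedSteps (γ η μ : ℝ) (χ d : PLQVar l p k n) : Set ℝ :=
  {t | (∃ i : ℕ, t = γ ^ i) ∧ PLQVar.Pos (χ + t • d) ∧
    ‖P.F μ (χ + t • d)‖ ≤ (1 - η * t) * ‖P.F μ χ‖}

/-- `it` is an infinite run of the interior point method, with line search parameters `γ`, `η`,
started at `χ₀` and `μ₀`. -/
structure IsRun (γ η : ℝ) (χ₀ : PLQVar l p k n) (μ₀ : ℝ) (it : ℕ → PLQIteration l p k n) :
    Prop where
  init_χ : (it 0).χ = χ₀
  init_μ : (it 0).μ = μ₀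
  newton : ∀ ν, fderiv ℝ (P.F (it ν).μ) (it ν).χ (it ν).d = -P.F (it ν).μ (it ν).χ
  line_search : ∀ ν, IsGreatest (P.acceptedSteps γ η (it ν).μ (it ν).χ (it ν).d) (it ν).t
  update_χ : ∀ ν, (it (ν + 1)).χ = (it ν).χ + (it ν).t • (it ν).d
  update_μ : ∀ ν, (it (ν + 1)).μ = (it (ν + 1)).χ.gap / (p + l : ℝ)

/-- The method is implementable: at every positive point the Newton matrix is invertible, and from
every admissible input the method generates a uniquely determined infinite sequence of iterations,
so that no step of it ever breaks down. -/
def Implementable : Prop :=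
  (∀ (μ : ℝ) (χ : PLQVar l p k n), 0 ≤ μ → χ.Pos →
    DifferentiableAt ℝ (P.F μ) χ ∧ (fderiv ℝ (P.F μ) χ).IsInvertible) ∧
  ∀ (γ η μ₀ : ℝ) (χ₀ : PLQVar l p k n), 0 < γ → γ < 1 → 0 < η → η < 1 → 0 ≤ μ₀ → χ₀.Pos →
    ∃! it : ℕ → PLQIteration l p k n, P.IsRun γ η χ₀ μ₀ it

end PLQProblem

end

/-! Everything rests on monotonicity of the linear equations. If `d` is in the kernel of their
linear part, the `C`, `A` and `B` terms of its gap cancel, and `gap_eq_of_lin_eq_zero` leaves `uᵀMu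
≥ 0`. If also the `q, w, s, r` blocks of `d` vanish, then `Mu = 0`, and the null condition and
injectivity of `B` give `d = 0` (`eq_zero_of_lin_eq_zero`).

Three facts follow. The Newton matrix is injective at positive points, since linearized
complementarity makes each product of increments nonpositive while their sum is nonnegative; the
same sign argument makes central points unique. The gap is convex on solutions of the linear
equations. Comparison with one strictly feasible point bounds every feasible set of bounded gap.

Central points exist because the sum of `v + μ²/v` over the complementarity products `v` has a
minimizer among strictly feasible points. Invertibility of the Newton matrix lets all products be
moved at prescribed rates, so stationarity forces `v = μ`. Small `μ` then yields strictly feasible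
points of small gap, and compactness yields gap zero. The line search succeeds because `F` is
exactly quadratic, and a KKT point is a saddle point of the problem defining `ρ`. -/

noncomputable section

/-! ### Block coordinates and the sign constraints. -/

namespace PLQVar

variable {l p k n : ℕ}

theorem ext_blocks {χ χ' : PLQVar l p k n} (hq : χ.q = χ'.q) (hw : χ.w = χ'.w) (hu : χ.u = χ'.u)
    (hy : χ.y = χ'.y) (hs : χ.s = χ'.s) (hr : χ.r = χ'.r) : χ = χ' := by
  ext i
  rcases i with i | i | i | i | i | i
  exacts [congrFun hq i, congrFun hw i, congrFun hu i, congrFun hy i, congrFun hs i, congrFun hr i]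

section mk
variable (q : Fin l → ℝ) (w : Fin p → ℝ) (u : Fin k → ℝ) (y : Fin n → ℝ) (s : Fin l → ℝ)
  (r : Fin p → ℝ)
@[simp] theorem q_mk : (mk q w u y s r).q = q := rfl
@[simp] theorem w_mk : (mk q w u y s r).w = w := rfl
@[simp] theorem u_mk : (mk q w u y s r).u = u := rfl
@[simp] theorem y_mk : (mk q w u y s r).y = y := rfl
@[simp] theorem s_mk : (mk q w u y s r).s = s := rfl
@[simp] theorem r_mk : (mk q w u y s r).r = r := rfl
end mk

section linear
variable (χ χ' : PLQVar l p k n) (t : ℝ)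
@[simp] theorem q_add : (χ + χ').q = χ.q + χ'.q := rfl
@[simp] theorem w_add : (χ + χ').w = χ.w + χ'.w := rfl
@[simp] theorem u_add : (χ + χ').u = χ.u + χ'.u := rfl
@[simp] theorem y_add : (χ + χ').y = χ.y + χ'.y := rfl
@[simp] theorem s_add : (χ + χ').s = χ.s + χ'.s := rfl
@[simp] theorem r_add : (χ + χ').r = χ.r + χ'.r := rfl
@[simp] theorem q_sub : (χ - χ').q = χ.q - χ'.q := rfl
@[simp] theorem w_sub : (χ - χ').w = χ.w - χ'.w := rfl
@[simp] theorem u_sub : (χ - χ').u = χ.u - χ'.u := rfl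
@[simp] theorem y_sub : (χ - χ').y = χ.y - χ'.y := rfl
@[simp] theorem s_sub : (χ - χ').s = χ.s - χ'.s := rfl
@[simp] theorem r_sub : (χ - χ').r = χ.r - χ'.r := rfl
@[simp] theorem q_smul : (t • χ).q = t • χ.q := rfl
@[simp] theorem w_smul : (t • χ).w = t • χ.w := rfl
@[simp] theorem u_smul : (t • χ).u = t • χ.u := rfl
@[simp] theorem y_smul : (t • χ).y = t • χ.y := rfl
@[simp] theorem s_smul : (t • χ).s = t • χ.s := rfl
@[simp] theorem r_smul : (t • χ).r = t • χ.r := rfl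
@[simp] theorem q_zero : (0 : PLQVar l p k n).q = 0 := rfl
@[simp] theorem w_zero : (0 : PLQVar l p k n).w = 0 := rfl
@[simp] theorem u_zero : (0 : PLQVar l p k n).u = 0 := rfl
@[simp] theorem y_zero : (0 : PLQVar l p k n).y = 0 := rfl
@[simp] theorem s_zero : (0 : PLQVar l p k n).s = 0 := rfl
@[simp] theorem r_zero : (0 : PLQVar l p k n).r = 0 := rfl
end linear

@[fun_prop] theorem continuous_q : Continuous (q : PLQVar l p k n → _) := by
  unfold q; fun_prop
@[fun_prop] theorem continuous_w : Continuous (w : PLQVar l p k n → _) := by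
  unfold w; fun_prop
@[fun_prop] theorem continuous_s : Continuous (s : PLQVar l p k n → _) := by
  unfold s; fun_prop
@[fun_prop] theorem continuous_r : Continuous (r : PLQVar l p k n → _) := by
  unfold r; fun_prop

@[fun_prop] theorem continuous_gap : Continuous (gap : PLQVar l p k n → ℝ) := by
  unfold gap dotProduct; fun_prop

theorem Pos.nonneg {χ : PLQVar l p k n} (h : χ.Pos) : χ.Nonneg :=
  ⟨fun i => (h.1 i).le, fun i => (h.2.1 i).le, fun i => (h.2.2.1 i).le, fun i => (h.2.2.2 i).le⟩

theorem Nonneg.gap_nonneg {χ : PLQVar l p k n} (h : χ.Nonneg) : 0 ≤ χ.gap :=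
  add_nonneg (Finset.sum_nonneg fun i _ => mul_nonneg (h.1 i) (h.2.2.1 i))
    (Finset.sum_nonneg fun i _ => mul_nonneg (h.2.1 i) (h.2.2.2 i))

theorem isClosed_nonneg : IsClosed {χ : PLQVar l p k n | χ.Nonneg} := by
  simp only [Nonneg, Set.ofPred_and, Set.ofPred_forall]
  refine IsClosed.inter ?_ (IsClosed.inter ?_ (IsClosed.inter ?_ ?_)) <;>
    exact isClosed_iInter fun i => isClosed_le (by fun_prop) (by fun_prop)

theorem isOpen_pos : IsOpen {χ : PLQVar l p k n | χ.Pos} := by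
  simp only [Pos, Set.ofPred_and, Set.ofPred_forall]
  refine IsOpen.inter ?_ (IsOpen.inter ?_ (IsOpen.inter ?_ ?_)) <;>
    exact isOpen_iInter_of_finite fun i => isOpen_lt (by fun_prop) (by fun_prop)

theorem convex_nonneg : Convex ℝ {χ : PLQVar l p k n | χ.Nonneg} := by
  intro x hx y hy a b ha hb _
  exact ⟨fun i => add_nonneg (mul_nonneg ha (hx.1 i)) (mul_nonneg hb (hy.1 i)),
    fun i => add_nonneg (mul_nonneg ha (hx.2.1 i)) (mul_nonneg hb (hy.2.1 i)),
    fun i => add_nonneg (mul_nonneg ha (hx.2.2.1 i)) (mul_nonneg hb (hy.2.2.1 i)),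
    fun i => add_nonneg (mul_nonneg ha (hx.2.2.2 i)) (mul_nonneg hb (hy.2.2.2 i))⟩

theorem Nonneg.smul_add_pos {x y : PLQVar l p k n} (hx : x.Nonneg) (hy : y.Pos) {a b : ℝ}
    (ha : 0 ≤ a) (hb : 0 < b) : (a • x + b • y).Pos :=
  ⟨fun i => add_pos_of_nonneg_of_pos (mul_nonneg ha (hx.1 i)) (mul_pos hb (hy.1 i)),
    fun i => add_pos_of_nonneg_of_pos (mul_nonneg ha (hx.2.1 i)) (mul_pos hb (hy.2.1 i)),
    fun i => add_pos_of_nonneg_of_pos (mul_nonneg ha (hx.2.2.1 i)) (mul_pos hb (hy.2.2.1 i)),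
    fun i => add_pos_of_nonneg_of_pos (mul_nonneg ha (hx.2.2.2 i)) (mul_pos hb (hy.2.2.2 i))⟩

theorem convex_pos : Convex ℝ {χ : PLQVar l p k n | χ.Pos} := by
  intro x hx y hy a b ha hb hab
  rcases hb.eq_or_lt with rfl | hb
  · rw [add_zero] at hab
    subst hab
    simpa using hx
  · exact hx.nonneg.smul_add_pos hy ha hb

/-- The bilinear complementarity products `(q_i s'_i, w_j r'_j)`, in the last two blocks. -/
def prod (χ χ' : PLQVar l p k n) : PLQVar l p k n :=
  mk 0 0 0 0 (χ.q * χ'.s) (χ.w * χ'.r)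

end PLQVar

/-! ### The linear equations, monotonicity and the Newton matrix. -/

namespace PLQProblem

variable {l p k n : ℕ} (P : PLQProblem l p k n)

/-- The linear part of `F`. -/
def lin : PLQVar l p k n →ₗ[ℝ] PLQVar l p k n where
  toFun χ := PLQVar.mk (P.Cᵀ *ᵥ χ.u + χ.s) (P.Aᵀ *ᵥ χ.y + χ.r)
    (P.M *ᵥ χ.u + P.C *ᵥ χ.q - P.B *ᵥ χ.y) (P.Bᵀ *ᵥ χ.u + P.A *ᵥ χ.w) 0 0
  map_add' χ χ' := by
    apply PLQVar.ext_blocks <;> simp [Matrix.mulVec_add] <;> abel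
  map_smul' t χ := by
    apply PLQVar.ext_blocks <;> simp [Matrix.mulVec_smul, smul_add, smul_sub]

theorem lin_apply (χ : PLQVar l p k n) : P.lin χ = PLQVar.mk (P.Cᵀ *ᵥ χ.u + χ.s)
    (P.Aᵀ *ᵥ χ.y + χ.r) (P.M *ᵥ χ.u + P.C *ᵥ χ.q - P.B *ᵥ χ.y) (P.Bᵀ *ᵥ χ.u + P.A *ᵥ χ.w) 0 0 :=
  rfl

theorem lin_eq_zero_iff {d : PLQVar l p k n} : P.lin d = 0 ↔
    P.Cᵀ *ᵥ d.u + d.s = 0 ∧ P.Aᵀ *ᵥ d.y + d.r = 0 ∧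
    P.M *ᵥ d.u + P.C *ᵥ d.q - P.B *ᵥ d.y = 0 ∧ P.Bᵀ *ᵥ d.u + P.A *ᵥ d.w = 0 := by
  constructor
  · intro h
    exact ⟨congrArg PLQVar.q h, congrArg PLQVar.w h, congrArg PLQVar.u h, congrArg PLQVar.y h⟩
  · rintro ⟨h₁, h₂, h₃, h₄⟩
    exact PLQVar.ext_blocks h₁ h₂ h₃ h₄ rfl rfl

/-- The right-hand side of the linear equations. -/
def rhs : PLQVar l p k n := PLQVar.mk P.c P.a P.b 0 0 0

theorem linearEqs_iff {χ : PLQVar l p k n} : P.LinearEqs χ ↔ P.lin χ = P.rhs := by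
  constructor
  · rintro ⟨h₁, h₂, h₃, h₄⟩
    refine PLQVar.ext_blocks ?_ ?_ ?_ h₄ rfl rfl
    · simp [lin_apply, rhs, h₁]
    · simp [lin_apply, rhs, h₂]
    · exact sub_eq_zero.1 h₃
  · intro h
    refine ⟨?_, ?_, sub_eq_zero.2 (congrArg PLQVar.u h), congrArg PLQVar.y h⟩
    · exact eq_sub_of_add_eq' (congrArg PLQVar.q h)
    · exact eq_sub_of_add_eq' (congrArg PLQVar.w h)

theorem LinearEqs.lin_sub {P : PLQProblem l p k n} {χ χ' : PLQVar l p k n} (h : P.LinearEqs χ)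
    (h' : P.LinearEqs χ') : P.lin (χ - χ') = 0 := by
  rw [map_sub, P.linearEqs_iff.1 h, P.linearEqs_iff.1 h', sub_self]

theorem LinearEqs.add_smul {P : PLQProblem l p k n} {χ d : PLQVar l p k n} (h : P.LinearEqs χ)
    (h' : P.lin d = 0) (t : ℝ) : P.LinearEqs (χ + t • d) := by
  rw [linearEqs_iff] at *
  rw [map_add, map_smul, h', h, smul_zero, add_zero]

theorem isClosed_linearEqs : IsClosed {χ : PLQVar l p k n | P.LinearEqs χ} := by
  simp only [linearEqs_iff]
  exact isClosed_eq P.lin.continuous_of_finiteDimensional continuous_const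

theorem convex_linearEqs : Convex ℝ {χ : PLQVar l p k n | P.LinearEqs χ} := by
  intro x hx y hy a b _ _ hab
  simp only [Set.mem_ofPred_eq, linearEqs_iff] at *
  rw [map_add, map_smul, map_smul, hx, hy, ← add_smul, hab, one_smul]

theorem isSymm_M : P.Mᵀ = P.M := by
  simpa [Matrix.conjTranspose_eq_transpose_of_trivial] using P.posSemidef_M.1.eq

theorem dotProduct_M_nonneg (x : Fin k → ℝ) : 0 ≤ x ⬝ᵥ P.M *ᵥ x := by
  simpa using P.posSemidef_M.dotProduct_mulVec_nonneg x

theorem M_mulVec_eq_zero {x : Fin k → ℝ} (h : x ⬝ᵥ P.M *ᵥ x = 0) : P.M *ᵥ x = 0 :=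
  (P.posSemidef_M.dotProduct_mulVec_zero_iff x).1 (by simpa using h)

/-- Apart from `M`, the system is skew-symmetric: `C`, `A` and `B` enter through pairs of adjoint
terms of opposite sign. -/
theorem gap_eq_of_lin_eq_zero {d : PLQVar l p k n} (h : P.lin d = 0) :
    d.gap = d.u ⬝ᵥ P.M *ᵥ d.u := by
  obtain ⟨h₁, h₂, h₃, h₄⟩ := P.lin_eq_zero_iff.1 h
  have e₁ : d.s = -(P.Cᵀ *ᵥ d.u) := eq_neg_of_add_eq_zero_right h₁
  have e₂ : d.r = -(P.Aᵀ *ᵥ d.y) := eq_neg_of_add_eq_zero_right h₂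
  have e₃ : P.C *ᵥ d.q = P.B *ᵥ d.y - P.M *ᵥ d.u := by
    rw [← sub_eq_zero, ← h₃]; abel
  have e₄ : P.A *ᵥ d.w = -(P.Bᵀ *ᵥ d.u) := eq_neg_of_add_eq_zero_right h₄
  have f₁ : d.q ⬝ᵥ P.Cᵀ *ᵥ d.u = d.u ⬝ᵥ P.C *ᵥ d.q := by
    rw [Matrix.mulVec_transpose, dotProduct_comm, Matrix.dotProduct_mulVec]
  have f₂ : d.w ⬝ᵥ P.Aᵀ *ᵥ d.y = d.y ⬝ᵥ P.A *ᵥ d.w := by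
    rw [Matrix.mulVec_transpose, dotProduct_comm, Matrix.dotProduct_mulVec]
  have f₃ : d.y ⬝ᵥ P.Bᵀ *ᵥ d.u = d.u ⬝ᵥ P.B *ᵥ d.y := by
    rw [Matrix.mulVec_transpose, dotProduct_comm, Matrix.dotProduct_mulVec]
  rw [PLQVar.gap, e₁, e₂, dotProduct_neg, dotProduct_neg, f₁, f₂, e₃, e₄, dotProduct_neg, f₃,
    dotProduct_sub]
  ring

theorem gap_nonneg_of_lin_eq_zero {d : PLQVar l p k n} (h : P.lin d = 0) : 0 ≤ d.gap := by
  rw [P.gap_eq_of_lin_eq_zero h]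
  exact P.dotProduct_M_nonneg _

/-- A direction in the kernel of the linear part is determined by its sign-constrained blocks. -/
theorem eq_zero_of_lin_eq_zero (hnull : P.NullCondition) {d : PLQVar l p k n} (h : P.lin d = 0)
    (hq : d.q = 0) (hw : d.w = 0) (hs : d.s = 0) (hr : d.r = 0) : d = 0 := by
  have hM : P.M *ᵥ d.u = 0 := by
    apply P.M_mulVec_eq_zero
    rw [← P.gap_eq_of_lin_eq_zero h]
    simp [PLQVar.gap, hq, hw]
  obtain ⟨h₁, -, h₃, h₄⟩ := P.lin_eq_zero_iff.1 h
  rw [hs, add_zero] at h₁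
  rw [hq, hM, Matrix.mulVec_zero, add_zero, zero_sub, neg_eq_zero] at h₃
  rw [hw, Matrix.mulVec_zero, add_zero] at h₄
  have hu : d.u = 0 := by
    have : d.u ∈ LinearMap.ker P.M.mulVecLin ⊓ LinearMap.ker P.Bᵀ.mulVecLin ⊓
        LinearMap.ker P.Cᵀ.mulVecLin := ⟨⟨hM, h₄⟩, h₁⟩
    rwa [hnull] at this
  have hy : d.y = 0 := P.injective_B (by rw [h₃, Matrix.mulVec_zero])
  exact PLQVar.ext_blocks hq hw hu hy hs hr

theorem F_eq (μ : ℝ) (χ : PLQVar l p k n) :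
    P.F μ χ = P.lin χ - P.rhs + PLQVar.prod χ χ -
      PLQVar.mk 0 0 0 0 (fun _ => μ) (fun _ => μ) := by
  apply PLQVar.ext_blocks <;> simp [F, lin_apply, rhs, PLQVar.prod] <;> rfl

/-- The Newton matrix of `F` at `χ`. -/
def newtonMap (χ : PLQVar l p k n) : PLQVar l p k n →ₗ[ℝ] PLQVar l p k n where
  toFun d := P.lin d + PLQVar.prod χ d + PLQVar.prod d χ
  map_add' d d' := by
    rw [map_add]
    apply PLQVar.ext_blocks <;> simp [PLQVar.prod, mul_add, add_mul] <;> abel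
  map_smul' t d := by
    rw [map_smul]
    apply PLQVar.ext_blocks <;> simp [PLQVar.prod, smul_add]

theorem newtonMap_apply (χ d : PLQVar l p k n) :
    P.newtonMap χ d = P.lin d + PLQVar.prod χ d + PLQVar.prod d χ := rfl

/-- The Taylor expansion stops at order two, as `F` is affine plus a bilinear term on the diagonal.
-/
theorem F_add_smul (μ : ℝ) (χ d : PLQVar l p k n) (t : ℝ) :
    P.F μ (χ + t • d) = P.F μ χ + t • P.newtonMap χ d + t ^ 2 • PLQVar.prod d d := by
  rw [F_eq, F_eq, newtonMap_apply, map_add, map_smul]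
  apply PLQVar.ext_blocks <;> simp [PLQVar.prod] <;> (try ext i) <;> simp <;> ring

/-- For a kernel direction, `x dz + dx z = 0` with `x, z > 0` gives `dx dz ≤ 0`. These products sum
to a gap that monotonicity makes nonnegative, so every increment in the sign-constrained blocks
vanishes. -/
theorem newtonMap_injective (hnull : P.NullCondition) {χ : PLQVar l p k n} (hχ : χ.Pos) :
    Function.Injective (P.newtonMap χ) := by
  rw [injective_iff_map_eq_zero]
  intro d hd
  have hlin : P.lin d = 0 := by
    rw [lin_eq_zero_iff]
    refine ⟨?_, ?_, ?_, ?_⟩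
    · simpa [newtonMap_apply, lin_apply, PLQVar.prod] using congrArg PLQVar.q hd
    · simpa [newtonMap_apply, lin_apply, PLQVar.prod] using congrArg PLQVar.w hd
    · simpa [newtonMap_apply, lin_apply, PLQVar.prod] using congrArg PLQVar.u hd
    · simpa [newtonMap_apply, lin_apply, PLQVar.prod] using congrArg PLQVar.y hd
  have h₁ (i) : χ.q i * d.s i + d.q i * χ.s i = 0 := by
    simpa [newtonMap_apply, lin_apply, PLQVar.prod] using congrFun (congrArg PLQVar.s hd) i
  have h₂ (i) : χ.w i * d.r i + d.w i * χ.r i = 0 := by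
    simpa [newtonMap_apply, lin_apply, PLQVar.prod] using congrFun (congrArg PLQVar.r hd) i
  have key {x z dx dz : ℝ} (hx : 0 < x) (hz : 0 < z) (h : x * dz + dx * z = 0) :
      dx * dz ≤ 0 ∧ (dx * dz = 0 → dx = 0 ∧ dz = 0) := by
    have e : dz = -(dx * z / x) := by field_simp; linarith
    have e' : dx * dz = -(dx ^ 2 * (z / x)) := by rw [e]; ring
    have hzx : 0 < z / x := div_pos hz hx
    refine ⟨by rw [e']; nlinarith [sq_nonneg dx], fun h0 => ?_⟩
    have : dx = 0 := by
      rw [e', neg_eq_zero, mul_eq_zero] at h0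
      simpa [hzx.ne'] using h0
    exact ⟨this, by rw [e, this]; simp⟩
  have k₁ (i) := key (hχ.1 i) (hχ.2.2.1 i) (h₁ i)
  have k₂ (i) := key (hχ.2.1 i) (hχ.2.2.2 i) (h₂ i)
  have n₁ : d.q ⬝ᵥ d.s ≤ 0 := Finset.sum_nonpos fun i _ => (k₁ i).1
  have n₂ : d.w ⬝ᵥ d.r ≤ 0 := Finset.sum_nonpos fun i _ => (k₂ i).1
  have hg : 0 ≤ d.q ⬝ᵥ d.s + d.w ⬝ᵥ d.r := P.gap_nonneg_of_lin_eq_zero hlin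
  have z₁ (i) : d.q i * d.s i = 0 :=
    (Finset.sum_eq_zero_iff_of_nonpos fun i _ => (k₁ i).1).1 (by
      change d.q ⬝ᵥ d.s = 0; linarith) i (Finset.mem_univ i)
  have z₂ (i) : d.w i * d.r i = 0 :=
    (Finset.sum_eq_zero_iff_of_nonpos fun i _ => (k₂ i).1).1 (by
      change d.w ⬝ᵥ d.r = 0; linarith) i (Finset.mem_univ i)
  exact P.eq_zero_of_lin_eq_zero hnull hlin (funext fun i => ((k₁ i).2 (z₁ i)).1)
    (funext fun i => ((k₂ i).2 (z₂ i)).1) (funext fun i => ((k₁ i).2 (z₁ i)).2)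
    (funext fun i => ((k₂ i).2 (z₂ i)).2)

end PLQProblem

/-! ### Derivative of the relaxed KKT map and the line search. -/

namespace PLQVar

variable {l p k n : ℕ}

theorem isBilinearMap_prod : IsBilinearMap ℝ (prod : PLQVar l p k n → PLQVar l p k n → _) where
  add_left x y z := by apply ext_blocks <;> simp [prod, add_mul]
  smul_left c x y := by apply ext_blocks <;> simp [prod]
  add_right x y z := by apply ext_blocks <;> simp [prod, mul_add]
  smul_right c x y := by apply ext_blocks <;> simp [prod]

end PLQVar

namespace PLQProblem

variable {l p k n : ℕ} (P : PLQProblem l p k n)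

theorem hasFDerivAt_F (μ : ℝ) (χ : PLQVar l p k n) :
    HasFDerivAt (P.F μ) (LinearMap.toContinuousLinearMap (P.newtonMap χ)) χ := by
  have h := ((((LinearMap.toContinuousLinearMap P.lin).hasFDerivAt (x := χ)).sub_const
    P.rhs).add (PLQVar.isBilinearMap_prod.toContinuousBilinearMap.hasFDerivAt_of_bilinear
      (hasFDerivAt_id χ) (hasFDerivAt_id χ))).sub_const
      (PLQVar.mk 0 0 0 0 (fun _ => μ) (fun _ => μ))
  refine (h.congr_fderiv ?_).congr_of_eventuallyEq (Eventually.of_forall (P.F_eq μ))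
  ext1 d
  simp [newtonMap_apply, add_assoc]

theorem fderiv_F_apply (μ : ℝ) (χ d : PLQVar l p k n) :
    fderiv ℝ (P.F μ) χ d = P.newtonMap χ d := by
  rw [(P.hasFDerivAt_F μ χ).fderiv]; rfl

/-- The Newton matrix at a positive point, as an invertible map. -/
def newtonEquiv (hnull : P.NullCondition) {χ : PLQVar l p k n} (hχ : χ.Pos) :
    PLQVar l p k n ≃ₗ[ℝ] PLQVar l p k n :=
  LinearEquiv.ofInjectiveEndo (P.newtonMap χ) (P.newtonMap_injective hnull hχ)

theorem isInvertible_fderiv_F (hnull : P.NullCondition) (μ : ℝ) {χ : PLQVar l p k n}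
    (hχ : χ.Pos) : (fderiv ℝ (P.F μ) χ).IsInvertible := by
  refine ⟨(P.newtonEquiv hnull hχ).toContinuousLinearEquiv, ?_⟩
  ext1 d
  rw [fderiv_F_apply]
  rfl

theorem exists_newtonMap_eq (hnull : P.NullCondition) {χ : PLQVar l p k n}
    (hχ : χ.Pos) (v : PLQVar l p k n) : ∃ d, P.newtonMap χ d = v :=
  (P.newtonEquiv hnull hχ).surjective v

theorem F_newton_step {μ : ℝ} {χ d : PLQVar l p k n} (hd : P.newtonMap χ d = -P.F μ χ) (t : ℝ) :
    P.F μ (χ + t • d) = (1 - t) • P.F μ χ + t ^ 2 • PLQVar.prod d d := by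
  rw [F_add_smul, hd, sub_smul, one_smul, smul_neg, sub_eq_add_neg]

/-- The line search along the Newton direction succeeds. -/
theorem exists_isGreatest_acceptedSteps (hnull : P.NullCondition) {γ η μ : ℝ} (hγ : 0 < γ)
    (hγ' : γ < 1) (hη' : η < 1) {χ d : PLQVar l p k n} (hχ : χ.Pos)
    (hd : P.newtonMap χ d = -P.F μ χ) : ∃ t, IsGreatest (P.acceptedSteps γ η μ χ d) t := by
  have hlim : Tendsto (fun i : ℕ => γ ^ i) atTop (𝓝 0) :=
    tendsto_pow_atTop_nhds_zero_of_lt_one hγ.le hγ'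
  have hpos : ∀ᶠ i : ℕ in atTop, PLQVar.Pos (χ + γ ^ i • d) := by
    have h : Tendsto (fun i : ℕ => χ + γ ^ i • d) atTop (𝓝 χ) := by
      simpa using tendsto_const_nhds.add (hlim.smul_const d)
    exact h.eventually (PLQVar.isOpen_pos.mem_nhds hχ)
  have hsmall : ∀ᶠ i : ℕ in atTop, γ ^ i * ‖PLQVar.prod d d‖ ≤ (1 - η) * ‖P.F μ χ‖ := by
    -- At a zero of `F` the right-hand side leaves no room, but the Newton direction is then zero
    -- and so is the quadratic error.
    by_cases hF : P.F μ χ = 0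
    · have hd0 : d = 0 := P.newtonMap_injective hnull hχ (by rw [hd, hF, neg_zero, map_zero])
      have hp : PLQVar.prod d d = 0 := by
        subst hd0
        apply PLQVar.ext_blocks <;> simp [PLQVar.prod]
      simp [hF, hp]
    · have h : Tendsto (fun i : ℕ => γ ^ i * ‖PLQVar.prod d d‖) atTop (𝓝 0) := by
        simpa using hlim.mul_const ‖PLQVar.prod d d‖
      exact h.eventually_le_const (mul_pos (by linarith) (norm_pos_iff.2 hF))
  have hex : ∃ i : ℕ, γ ^ i ∈ P.acceptedSteps γ η μ χ d := by
    obtain ⟨i, hi, hi'⟩ := (hpos.and hsmall).exists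
    refine ⟨i, ⟨i, rfl⟩, hi, ?_⟩
    have h0 : 0 < γ ^ i := pow_pos hγ i
    have h1 : γ ^ i ≤ 1 := pow_le_one₀ hγ.le hγ'.le
    rw [P.F_newton_step hd]
    calc _ ≤ ‖(1 - γ ^ i) • P.F μ χ‖ + ‖(γ ^ i) ^ 2 • PLQVar.prod d d‖ := norm_add_le _ _
      _ = (1 - γ ^ i) * ‖P.F μ χ‖ + γ ^ i * (γ ^ i * ‖PLQVar.prod d d‖) := by
        rw [norm_smul, norm_smul, Real.norm_of_nonneg (by linarith),
          Real.norm_of_nonneg (by positivity)]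
        ring
      _ ≤ (1 - γ ^ i) * ‖P.F μ χ‖ + γ ^ i * ((1 - η) * ‖P.F μ χ‖) := by gcongr
      _ = (1 - η * γ ^ i) * ‖P.F μ χ‖ := by ring
  classical
  refine ⟨γ ^ Nat.find hex, Nat.find_spec hex, ?_⟩
  rintro t ht
  obtain ⟨i, rfl⟩ := ht.1
  exact pow_le_pow_of_le_one hγ.le hγ'.le (Nat.find_min' hex ht)

/-! ### Runs of the method. -/

/-- One step of the method from `(χ, μ)` to its direction and step length. -/
def IsStep (γ η : ℝ) (it : PLQIteration l p k n) : Prop :=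
  fderiv ℝ (P.F it.μ) it.χ it.d = -P.F it.μ it.χ ∧
    IsGreatest (P.acceptedSteps γ η it.μ it.χ it.d) it.t

theorem IsStep.pos {P : PLQProblem l p k n} {γ η : ℝ} {it : PLQIteration l p k n}
    (h : P.IsStep γ η it) : (it.χ + it.t • it.d).Pos := h.2.1.2.1

theorem exists_isStep (hnull : P.NullCondition) {γ η : ℝ} (hγ : 0 < γ)
    (hγ' : γ < 1) (hη' : η < 1) (χ : PLQVar l p k n) (μ : ℝ) (hχ : χ.Pos) :
    ∃ it : PLQIteration l p k n, it.χ = χ ∧ it.μ = μ ∧ P.IsStep γ η it := by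
  obtain ⟨d, hd⟩ := P.exists_newtonMap_eq hnull hχ (-P.F μ χ)
  obtain ⟨t, ht⟩ := P.exists_isGreatest_acceptedSteps hnull hγ hγ' hη' hχ hd
  exact ⟨⟨χ, μ, d, t⟩, rfl, rfl, by rw [fderiv_F_apply]; exact hd, ht⟩

theorem IsStep.eq {P : PLQProblem l p k n} (hnull : P.NullCondition) {γ η : ℝ}
    {it it' : PLQIteration l p k n} (h : P.IsStep γ η it) (h' : P.IsStep γ η it')
    (hχ : it.χ.Pos) (eχ : it.χ = it'.χ) (eμ : it.μ = it'.μ) : it = it' := by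
  obtain ⟨χ, μ, d, t⟩ := it
  obtain ⟨χ', μ', d', t'⟩ := it'
  obtain rfl : χ = χ' := eχ
  obtain rfl : μ = μ' := eμ
  obtain ⟨hd, ht⟩ := h
  obtain ⟨hd', ht'⟩ := h'
  simp only [fderiv_F_apply] at hd hd' ht ht'
  obtain rfl : d = d' := P.newtonMap_injective hnull hχ (hd.trans hd'.symm)
  obtain rfl : t = t' := ht.unique ht'
  rfl

/-- An accepted step ends at a positive point, which is all the next step needs; each step is
determined by its `χ` and `μ`, so induction gives existence and uniqueness. -/
theorem existsUnique_isRun (hnull : P.NullCondition) {γ η μ₀ : ℝ} {χ₀ : PLQVar l p k n}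
    (hγ : 0 < γ) (hγ' : γ < 1) (hη' : η < 1) (hχ₀ : χ₀.Pos) :
    ∃! it : ℕ → PLQIteration l p k n, P.IsRun γ η χ₀ μ₀ it := by
  -- A junk value for `choose!`, which makes `f` total in `χ` although steps are only provided from
  -- positive points.
  have : Nonempty (PLQIteration l p k n) := ⟨⟨0, 0, 0, 0⟩⟩
  choose! f hfχ hfμ hf using P.exists_isStep hnull hγ hγ' hη'
  let next (x : PLQIteration l p k n) : PLQIteration l p k n :=
    f (x.χ + x.t • x.d) ((x.χ + x.t • x.d).gap / (p + l : ℝ))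
  let it (ν : ℕ) : PLQIteration l p k n := next^[ν] (f χ₀ μ₀)
  have hsucc (ν) : it (ν + 1) = next (it ν) := Function.iterate_succ_apply' _ _ _
  have hstep (ν) : P.IsStep γ η (it ν) := by
    induction ν with
    | zero => exact hf _ _ hχ₀
    | succ ν ih => rw [hsucc]; exact hf _ _ ih.pos
  have hχ (ν) : (it (ν + 1)).χ = (it ν).χ + (it ν).t • (it ν).d := by
    rw [hsucc]; exact hfχ _ _ (hstep ν).pos
  have hμ (ν) : (it (ν + 1)).μ = (it (ν + 1)).χ.gap / (p + l : ℝ) := by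
    rw [hχ, hsucc]; exact hfμ _ _ (hstep ν).pos
  refine ⟨it, ⟨hfχ _ _ hχ₀, hfμ _ _ hχ₀, fun ν => (hstep ν).1, fun ν => (hstep ν).2, hχ, hμ⟩, ?_⟩
  intro it' h'
  have hstep' (ν) : P.IsStep γ η (it' ν) := ⟨h'.newton ν, h'.line_search ν⟩
  funext ν
  induction ν with
  | zero =>
    refine (hstep' 0).eq hnull (hstep 0) (by rw [h'.init_χ]; exact hχ₀) ?_ ?_
    · rw [h'.init_χ]; exact (hfχ _ _ hχ₀).symm
    · rw [h'.init_μ]; exact (hfμ _ _ hχ₀).symm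
  | succ ν ih =>
    have e : (it' (ν + 1)).χ = (it (ν + 1)).χ := by rw [h'.update_χ, hχ, ih]
    refine (hstep' _).eq hnull (hstep _) ?_ e (by rw [h'.update_μ, hμ, e])
    rw [h'.update_χ]
    exact (hstep' ν).pos

theorem implementable (hnull : P.NullCondition) : P.Implementable :=
  ⟨fun μ χ _ hχ => ⟨(P.hasFDerivAt_F μ χ).differentiableAt, P.isInvertible_fderiv_F hnull μ hχ⟩,
    fun _ _ _ _ hγ hγ' _ hη' _ hχ₀ => P.existsUnique_isRun hnull hγ hγ' hη' hχ₀⟩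

end PLQProblem

/-! ### Convexity and compactness of the feasible sets of bounded gap. -/

namespace PLQVar

variable {l p k n : ℕ}

theorem gap_convex_combination (x y : PLQVar l p k n) {a b : ℝ} (hab : a + b = 1) :
    (a • x + b • y).gap = a * x.gap + b * y.gap - a * b * (x - y).gap := by
  obtain rfl : b = 1 - a := by linarith
  simp only [gap, q_add, q_smul, s_add, s_smul, w_add, w_smul, r_add, r_smul, q_sub, s_sub, w_sub,
    r_sub, add_dotProduct, dotProduct_add, smul_dotProduct, dotProduct_smul, sub_dotProduct,
    dotProduct_sub, smul_eq_mul]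
  ring

/-- The complementarity products `q_i s_i` and `w_j r_j`. -/
def comp (χ : PLQVar l p k n) : Fin l ⊕ Fin p → ℝ := Sum.elim (χ.q * χ.s) (χ.w * χ.r)

theorem sum_comp (χ : PLQVar l p k n) : ∑ i, χ.comp i = χ.gap := by
  simp [comp, gap, dotProduct]

@[fun_prop] theorem continuous_comp (i : Fin l ⊕ Fin p) :
    Continuous fun χ : PLQVar l p k n => χ.comp i := by
  rcases i with i | i <;> simp only [comp, Sum.elim_inl, Sum.elim_inr, Pi.mul_apply] <;> fun_prop

theorem Pos.comp_pos {χ : PLQVar l p k n} (h : χ.Pos) (i) : 0 < χ.comp i := by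
  rcases i with i | i
  exacts [mul_pos (h.1 i) (h.2.2.1 i), mul_pos (h.2.1 i) (h.2.2.2 i)]

theorem Nonneg.pos_of_comp_pos {χ : PLQVar l p k n} (h : χ.Nonneg) (h' : ∀ i, 0 < χ.comp i) :
    χ.Pos :=
  ⟨fun i => pos_of_mul_pos_left (h' (.inl i)) (h.2.2.1 i),
    fun i => pos_of_mul_pos_left (h' (.inr i)) (h.2.2.2 i),
    fun i => pos_of_mul_pos_right (h' (.inl i)) (h.1 i),
    fun i => pos_of_mul_pos_right (h' (.inr i)) (h.2.1 i)⟩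

end PLQVar

namespace PLQProblem

variable {l p k n : ℕ} (P : PLQProblem l p k n)

/-- The gap is quadratic, and its curvature along a difference of two solutions is the gap of that
difference, nonnegative by monotonicity. -/
theorem convex_setOf_gap_le (τ : ℝ) :
    Convex ℝ {χ : PLQVar l p k n | P.LinearEqs χ ∧ χ.gap ≤ τ} := by
  intro x hx y hy a b ha hb hab
  refine ⟨P.convex_linearEqs hx.1 hy.1 ha hb hab, ?_⟩
  have h := P.gap_nonneg_of_lin_eq_zero (hx.1.lin_sub hy.1)
  rw [PLQVar.gap_convex_combination x y hab]
  have h1 := mul_le_mul_of_nonneg_left hx.2 ha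
  have h2 := mul_le_mul_of_nonneg_left hy.2 hb
  have h3 := mul_nonneg (mul_nonneg ha hb) h
  have h4 : a * τ + b * τ = τ := by rw [← add_mul, hab, one_mul]
  linarith

theorem feasible_eq (τ : ℝ) :
    P.feasible τ = {χ | χ.Nonneg} ∩ {χ | P.LinearEqs χ ∧ χ.gap ≤ τ} := by
  simp only [feasible, EReal.coe_le_coe_iff]; rfl

theorem strictFeasible_eq (τ : ℝ) :
    P.strictFeasible τ = {χ | χ.Pos} ∩ {χ | P.LinearEqs χ ∧ χ.gap ≤ τ} := by
  simp only [strictFeasible, EReal.coe_le_coe_iff]; rfl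

theorem mem_feasible {τ : ℝ} {χ : PLQVar l p k n} :
    χ ∈ P.feasible τ ↔ χ.Nonneg ∧ P.LinearEqs χ ∧ χ.gap ≤ τ := by
  rw [feasible_eq]; rfl

theorem mem_strictFeasible {τ : ℝ} {χ : PLQVar l p k n} :
    χ ∈ P.strictFeasible τ ↔ χ.Pos ∧ P.LinearEqs χ ∧ χ.gap ≤ τ := by
  rw [strictFeasible_eq]; rfl

theorem convex_feasible (τ : ℝ) : Convex ℝ (P.feasible τ) := by
  rw [feasible_eq]
  exact PLQVar.convex_nonneg.inter (P.convex_setOf_gap_le τ)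

theorem convex_strictFeasible (τ : ℝ) : Convex ℝ (P.strictFeasible τ) := by
  rw [strictFeasible_eq]
  exact PLQVar.convex_pos.inter (P.convex_setOf_gap_le τ)

theorem isClosed_feasible (τ : ℝ) : IsClosed (P.feasible τ) := by
  rw [feasible_eq]
  exact PLQVar.isClosed_nonneg.inter
    (P.isClosed_linearEqs.inter (isClosed_le PLQVar.continuous_gap continuous_const))

/-- The linear part of the equations together with the sign-constrained blocks. -/
def linBlocks : PLQVar l p k n →ₗ[ℝ]
    PLQVar l p k n × (Fin l → ℝ) × (Fin p → ℝ) × (Fin l → ℝ) × (Fin p → ℝ) where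
  toFun χ := (P.lin χ, χ.q, χ.w, χ.s, χ.r)
  map_add' χ χ' := by simp
  map_smul' t χ := by simp

theorem isBounded_feasible (hnull : P.NullCondition) {χ₁ : PLQVar l p k n} (h₁ : χ₁.Pos)
    (h₁' : P.LinearEqs χ₁) (τ : ℝ) : Bornology.IsBounded (P.feasible τ) := by
  have hinj : LinearMap.ker P.linBlocks = ⊥ := by
    refine LinearMap.ker_eq_bot'.2 fun d hd => ?_
    simp only [linBlocks, LinearMap.coe_mk, AddHom.coe_mk, Prod.mk_eq_zero] at hd
    exact P.eq_zero_of_lin_eq_zero hnull hd.1 hd.2.1 hd.2.2.1 hd.2.2.2.1 hd.2.2.2.2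
  obtain ⟨K, -, hK⟩ := P.linBlocks.exists_antilipschitzWith hinj
  -- Expanding `(χ - χ₁).gap ≥ 0` bounds the sum of all cross products of `χ` with `χ₁` by `χ.gap +
  -- χ₁.gap ≤ R`. Each cross product is nonnegative, so each coordinate of `χ` is at most `R` over a
  -- positive coordinate of `χ₁`.
  set R := τ + χ₁.gap
  refine (hK.isBounded_preimage (s := {P.rhs} ×ˢ Set.Icc 0 (fun i => R / χ₁.s i) ×ˢ
    Set.Icc 0 (fun i => R / χ₁.r i) ×ˢ Set.Icc 0 (fun i => R / χ₁.q i) ×ˢ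
    Set.Icc 0 (fun i => R / χ₁.w i)) ?_).subset ?_
  · exact Bornology.isBounded_singleton.prod ((Metric.isBounded_Icc _ _).prod
      ((Metric.isBounded_Icc _ _).prod ((Metric.isBounded_Icc _ _).prod
        (Metric.isBounded_Icc _ _))))
  · intro χ hχ
    obtain ⟨hn, hl, hg⟩ := P.mem_feasible.1 hχ
    have hmon := P.gap_nonneg_of_lin_eq_zero (hl.lin_sub h₁')
    have hexp : (χ - χ₁).gap = χ.gap + χ₁.gap - (χ.q ⬝ᵥ χ₁.s + χ.w ⬝ᵥ χ₁.r +
        (χ.s ⬝ᵥ χ₁.q + χ.r ⬝ᵥ χ₁.w)) := by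
      simp only [PLQVar.gap, PLQVar.q_sub, PLQVar.s_sub, PLQVar.w_sub, PLQVar.r_sub,
        sub_dotProduct, dotProduct_sub, dotProduct_comm χ.s, dotProduct_comm χ.r]
      ring
    have single {m : ℕ} {x z : Fin m → ℝ} (hx : ∀ i, 0 ≤ x i) (hz : ∀ i, 0 < z i) (i : Fin m) :
        x i * z i ≤ x ⬝ᵥ z :=
      Finset.single_le_sum (f := fun i => x i * z i)
        (fun j _ => mul_nonneg (hx j) (hz j).le) (Finset.mem_univ i)
    have nn {m : ℕ} {x z : Fin m → ℝ} (hx : ∀ i, 0 ≤ x i) (hz : ∀ i, 0 < z i) :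
        0 ≤ x ⬝ᵥ z := Finset.sum_nonneg fun j _ => mul_nonneg (hx j) (hz j).le
    have n₁ := nn hn.1 h₁.2.2.1
    have n₂ := nn hn.2.1 h₁.2.2.2
    have n₃ := nn hn.2.2.1 h₁.1
    have n₄ := nn hn.2.2.2 h₁.2.1
    refine ⟨P.linearEqs_iff.1 hl, ⟨hn.1, fun i => ?_⟩, ⟨hn.2.1, fun i => ?_⟩,
      ⟨hn.2.2.1, fun i => ?_⟩, ⟨hn.2.2.2, fun i => ?_⟩⟩
    · rw [le_div_iff₀ (h₁.2.2.1 i)]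
      exact (single hn.1 h₁.2.2.1 i).trans (by linarith)
    · rw [le_div_iff₀ (h₁.2.2.2 i)]
      exact (single hn.2.1 h₁.2.2.2 i).trans (by linarith)
    · rw [le_div_iff₀ (h₁.1 i)]
      exact (single hn.2.2.1 h₁.1 i).trans (by linarith)
    · rw [le_div_iff₀ (h₁.2.1 i)]
      exact (single hn.2.2.2 h₁.2.1 i).trans (by linarith)

theorem isCompact_feasible (hnull : P.NullCondition) {χ₁ : PLQVar l p k n} (h₁ : χ₁.Pos)
    (h₁' : P.LinearEqs χ₁) (τ : ℝ) : IsCompact (P.feasible τ) :=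
  Metric.isCompact_of_isClosed_isBounded (P.isClosed_feasible τ)
    (P.isBounded_feasible hnull h₁ h₁' τ)

/-! ### Uniqueness and existence on the central path. -/

theorem F_eq_zero_iff {μ : ℝ} {χ : PLQVar l p k n} :
    P.F μ χ = 0 ↔ P.LinearEqs χ ∧ ∀ i, χ.comp i = μ := by
  constructor
  · intro h
    have hq : P.Cᵀ *ᵥ χ.u + χ.s - P.c = 0 := congrArg PLQVar.q h
    have hw : P.Aᵀ *ᵥ χ.y + χ.r - P.a = 0 := congrArg PLQVar.w h
    refine ⟨⟨?_, ?_, congrArg PLQVar.u h, congrArg PLQVar.y h⟩, ?_⟩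
    · rw [← sub_eq_zero, ← hq]; abel
    · rw [← sub_eq_zero, ← hw]; abel
    · rintro (i | i)
      · exact sub_eq_zero.1 (congrFun (congrArg PLQVar.s h) i)
      · exact sub_eq_zero.1 (congrFun (congrArg PLQVar.r h) i)
  · rintro ⟨⟨h₁, h₂, h₃, h₄⟩, h⟩
    refine PLQVar.ext_blocks ?_ ?_ h₃ h₄ (funext fun i => sub_eq_zero.2 (h (.inl i)))
      (funext fun i => sub_eq_zero.2 (h (.inr i)))
    · simp [F, h₁]
    · simp [F, h₂]

theorem IsCentral.pos {P : PLQProblem l p k n} {μ : ℝ} {χ : PLQVar l p k n}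
    (h : P.IsCentral μ χ) (hμ : 0 < μ) : χ.Pos :=
  h.2.pos_of_comp_pos fun i => by rwa [(P.F_eq_zero_iff.1 h.1).2 i]

theorem IsCentral.gap_eq {P : PLQProblem l p k n} {μ : ℝ} {χ : PLQVar l p k n}
    (h : P.IsCentral μ χ) : χ.gap = (l + p) * μ := by
  rw [← PLQVar.sum_comp, Finset.sum_congr rfl fun i _ => (P.F_eq_zero_iff.1 h.1).2 i]
  simp

theorem IsCentral.mem_feasible {P : PLQProblem l p k n} {μ τ : ℝ} {χ : PLQVar l p k n}
    (h : P.IsCentral μ χ) (hτ : (l + p) * μ ≤ τ) : χ ∈ P.feasible τ :=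
  P.mem_feasible.2 ⟨h.2, (P.F_eq_zero_iff.1 h.1).1, h.gap_eq.trans_le hτ⟩

/-- On the hyperbola `xz = μ`, `x, z > 0`, the two coordinates change in opposite directions, so the
difference of two central points has nonpositive products; monotonicity makes them zero. -/
theorem IsCentral.eq {P : PLQProblem l p k n} (hnull : P.NullCondition) {μ : ℝ} (hμ : 0 < μ)
    {χ χ' : PLQVar l p k n} (h : P.IsCentral μ χ) (h' : P.IsCentral μ χ') : χ = χ' := by
  have hp := h.pos hμ
  have hp' := h'.pos hμ
  obtain ⟨hl, hc⟩ := P.F_eq_zero_iff.1 h.1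
  obtain ⟨hl', hc'⟩ := P.F_eq_zero_iff.1 h'.1
  have hlin := hl.lin_sub hl'
  have key {x z x' z' : ℝ} (hx : 0 < x) (hx' : 0 < x') (e : x * z = μ)
      (e' : x' * z' = μ) : (x - x') * (z - z') ≤ 0 ∧
      ((x - x') * (z - z') = 0 → x - x' = 0 ∧ z - z' = 0) := by
    obtain rfl : z = μ / x := by field_simp; linarith
    obtain rfl : z' = μ / x' := by field_simp; linarith
    have e : (x - x') * (μ / x - μ / x') = -((x - x') ^ 2 * (μ / (x * x'))) := by
      field_simp; ring
    have hpos : 0 < μ / (x * x') := by positivity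
    rw [e]
    refine ⟨neg_nonpos.2 (mul_nonneg (sq_nonneg _) hpos.le), fun h0 => ?_⟩
    have h1 : x - x' = 0 := by
      rw [neg_eq_zero, mul_eq_zero] at h0
      simpa [hpos.ne'] using h0
    exact ⟨h1, by rw [sub_eq_zero.1 h1, sub_self]⟩
  have k₁ (i) := key (hp.1 i) (hp'.1 i) (hc (.inl i)) (hc' (.inl i))
  have k₂ (i) := key (hp.2.1 i) (hp'.2.1 i) (hc (.inr i)) (hc' (.inr i))
  have hsum : ∑ i, (χ - χ').comp i = 0 := by
    refine le_antisymm (Finset.sum_nonpos ?_) ?_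
    · rintro (i | i) -
      exacts [(k₁ i).1, (k₂ i).1]
    · rw [PLQVar.sum_comp]
      exact P.gap_nonneg_of_lin_eq_zero hlin
  have hz (i) : (χ - χ').comp i = 0 := by
    refine (Finset.sum_eq_zero_iff_of_nonpos ?_).1 hsum i (Finset.mem_univ i)
    rintro (i | i) -
    exacts [(k₁ i).1, (k₂ i).1]
  exact sub_eq_zero.1 (P.eq_zero_of_lin_eq_zero hnull hlin
    (funext fun i => ((k₁ i).2 (hz (.inl i))).1) (funext fun i => ((k₂ i).2 (hz (.inr i))).1)
    (funext fun i => ((k₁ i).2 (hz (.inl i))).2) (funext fun i => ((k₂ i).2 (hz (.inr i))).2))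

/-- A coercive potential on the strictly feasible points; its minimizers are central. -/
def potential (μ : ℝ) (χ : PLQVar l p k n) : ℝ := ∑ i, (χ.comp i + μ ^ 2 / χ.comp i)

/-- The terms `v` control the gap, hence compactness; the terms `μ²/v` keep minimizing points off
the boundary. -/
theorem comp_bounds {μ R : ℝ} {χ : PLQVar l p k n} (hχ : χ.Pos)
    (hR : potential μ χ ≤ R) : χ.gap ≤ R ∧ ∀ i, μ ^ 2 ≤ R * χ.comp i := by
  have hterm (i) : 0 ≤ μ ^ 2 / χ.comp i := div_nonneg (sq_nonneg _) (hχ.comp_pos i).le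
  constructor
  · refine le_trans ?_ hR
    rw [← PLQVar.sum_comp]
    exact Finset.sum_le_sum fun i _ => le_add_of_nonneg_right (hterm i)
  · intro i
    rw [← div_le_iff₀ (hχ.comp_pos i)]
    refine le_trans ?_ hR
    refine le_trans ?_ (Finset.single_le_sum (f := fun i => χ.comp i + μ ^ 2 / χ.comp i)
      (fun j _ => add_nonneg (hχ.comp_pos j).le (hterm j)) (Finset.mem_univ i))
    exact le_add_of_nonneg_left (hχ.comp_pos i).le

theorem exists_min_potential (hnull : P.NullCondition) {χ₁ : PLQVar l p k n} (h₁ : χ₁.Pos)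
    (h₁' : P.LinearEqs χ₁) {μ : ℝ} (hμ : 0 < μ) :
    ∃ χ : PLQVar l p k n, χ.Pos ∧ P.LinearEqs χ ∧
      ∀ χ' : PLQVar l p k n, χ'.Pos → P.LinearEqs χ' → potential μ χ ≤ potential μ χ' := by
  set R := potential μ χ₁ with hR
  have hR0 : 0 ≤ R := Finset.sum_nonneg fun i _ =>
    add_nonneg (h₁.comp_pos i).le (div_nonneg (sq_nonneg _) (h₁.comp_pos i).le)
  -- A compact set containing the sublevel set of `χ₁`; its closed second condition replaces strict
  -- positivity and keeps the potential continuous.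
  set S : Set (PLQVar l p k n) := P.feasible R ∩ {χ | ∀ i, μ ^ 2 ≤ R * χ.comp i} with hS
  have hmem {χ : PLQVar l p k n} (h : χ.Pos) (h' : P.LinearEqs χ) (hle : potential μ χ ≤ R) :
      χ ∈ S :=
    ⟨P.mem_feasible.2 ⟨h.nonneg, h', (comp_bounds h hle).1⟩, (comp_bounds h hle).2⟩
  have hcomp {χ : PLQVar l p k n} (h : χ ∈ S) (i) : 0 < χ.comp i :=
    pos_of_mul_pos_right ((pow_pos hμ 2).trans_le (h.2 i)) hR0
  have hSc : IsCompact S := by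
    refine (P.isCompact_feasible hnull h₁ h₁' R).inter_right ?_
    simp only [Set.ofPred_forall]
    exact isClosed_iInter fun i => isClosed_le (by fun_prop) (by fun_prop)
  have hcont : ContinuousOn (potential μ) S := by
    unfold potential
    refine continuousOn_finsetSum _ fun i _ => ?_
    exact (PLQVar.continuous_comp i).continuousOn.add (continuousOn_const.div
      (PLQVar.continuous_comp i).continuousOn fun χ hχ => (hcomp hχ i).ne')
  obtain ⟨χ, hχ, hmin⟩ := hSc.exists_isMinOn ⟨χ₁, hmem h₁ h₁' le_rfl⟩ hcont
  obtain ⟨hn, hl, -⟩ := P.mem_feasible.1 hχ.1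
  refine ⟨χ, hn.pos_of_comp_pos (hcomp hχ), hl, fun χ' hp' hl' => ?_⟩
  rcases le_total (potential μ χ') R with h | h
  · exact hmin (hmem hp' hl' h)
  · exact (hmin (hmem h₁ h₁' le_rfl)).trans h

theorem exists_isCentral (hnull : P.NullCondition) {χ₁ : PLQVar l p k n} (h₁ : χ₁.Pos)
    (h₁' : P.LinearEqs χ₁) {μ : ℝ} (hμ : 0 < μ) : ∃ χ, P.IsCentral μ χ := by
  obtain ⟨χ, hp, hl, hmin⟩ := P.exists_min_potential hnull h₁ h₁' hμ
  -- The partial derivatives of the potential in the products. The direction `d` moves product `i`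
  -- at rate `g i` while preserving the linear equations, so the derivative along `d` is `∑ g i ^
  -- 2`, zero at a minimizer.
  set g : Fin l ⊕ Fin p → ℝ := fun i => 1 - μ ^ 2 / χ.comp i ^ 2 with hg
  obtain ⟨d, hd⟩ := P.exists_newtonMap_eq hnull hp
    (PLQVar.mk 0 0 0 0 (fun i => g (.inl i)) (fun i => g (.inr i)))
  have hlin : P.lin d = 0 := by
    rw [lin_eq_zero_iff]
    refine ⟨?_, ?_, ?_, ?_⟩
    · simpa [newtonMap_apply, lin_apply, PLQVar.prod] using congrArg PLQVar.q hd
    · simpa [newtonMap_apply, lin_apply, PLQVar.prod] using congrArg PLQVar.w hd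
    · simpa [newtonMap_apply, lin_apply, PLQVar.prod] using congrArg PLQVar.u hd
    · simpa [newtonMap_apply, lin_apply, PLQVar.prod] using congrArg PLQVar.y hd
  have hcomp (t : ℝ) (i) : (χ + t • d).comp i = χ.comp i + t * g i + t ^ 2 * d.comp i := by
    rcases i with i | i
    · have e : χ.q i * d.s i + d.q i * χ.s i = g (.inl i) := by
        simpa [newtonMap_apply, lin_apply, PLQVar.prod] using congrFun (congrArg PLQVar.s hd) i
      simp only [← e, PLQVar.comp, Sum.elim_inl, Pi.mul_apply, PLQVar.q_add, PLQVar.s_add,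
        PLQVar.q_smul, PLQVar.s_smul, Pi.add_apply, Pi.smul_apply, smul_eq_mul]
      ring
    · have e : χ.w i * d.r i + d.w i * χ.r i = g (.inr i) := by
        simpa [newtonMap_apply, lin_apply, PLQVar.prod] using congrFun (congrArg PLQVar.r hd) i
      simp only [← e, PLQVar.comp, Sum.elim_inr, Pi.mul_apply, PLQVar.w_add, PLQVar.r_add,
        PLQVar.w_smul, PLQVar.r_smul, Pi.add_apply, Pi.smul_apply, smul_eq_mul]
      ring
  have hlocal : IsLocalMin (fun t : ℝ => potential μ (χ + t • d)) 0 := by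
    have hc : Tendsto (fun t : ℝ => χ + t • d) (𝓝 0) (𝓝 χ) := by
      have : Continuous fun t : ℝ => χ + t • d := by fun_prop
      simpa using this.tendsto 0
    filter_upwards [hc.eventually (PLQVar.isOpen_pos.mem_nhds hp)] with t ht
    simpa using hmin _ ht (hl.add_smul hlin t)
  have hder : HasDerivAt (fun t : ℝ => potential μ (χ + t • d)) (∑ i, g i ^ 2) 0 := by
    unfold potential
    refine HasDerivAt.fun_sum fun i _ => ?_
    have hv : HasDerivAt (fun t : ℝ => (χ + t • d).comp i) (g i) 0 := by
      simp only [hcomp]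
      have := (((hasDerivAt_id' (0 : ℝ)).mul_const (g i)).const_add (χ.comp i)).fun_add
        (((hasDerivAt_id' (0 : ℝ)).fun_pow 2).mul_const (d.comp i))
      simpa using this
    have hv0 : (χ + (0 : ℝ) • d).comp i = χ.comp i := by simp
    have hne : χ.comp i ≠ 0 := (hp.comp_pos i).ne'
    have := hv.add ((hasDerivAt_const (0 : ℝ) (μ ^ 2)).div hv (by rwa [hv0]))
    refine this.congr_deriv ?_
    rw [hv0, hg]
    field_simp
    ring
  have hzero := hlocal.hasDerivAt_eq_zero hder
  refine ⟨χ, P.F_eq_zero_iff.2 ⟨hl, fun i => ?_⟩, hp.nonneg⟩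
  have hi : g i = 0 := pow_eq_zero_iff two_ne_zero |>.1 <|
    (Finset.sum_eq_zero_iff_of_nonneg fun i _ => sq_nonneg (g i)).1 hzero i (Finset.mem_univ i)
  have hv := hp.comp_pos i
  have hsq : χ.comp i ^ 2 = μ ^ 2 := by
    simp only [hg] at hi
    field_simp at hi
    linarith
  exact (pow_left_inj₀ hv.le hμ.le two_ne_zero).1 hsq

/-! ### Nonemptiness and closure. -/

theorem strictFeasible_nonempty (hnull : P.NullCondition) {χ₁ : PLQVar l p k n} (h₁ : χ₁.Pos)
    (h₁' : P.LinearEqs χ₁) {τ : ℝ} (hτ : 0 < τ) : (P.strictFeasible τ).Nonempty := by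
  -- A central point has gap `(l + p) * μ`; the extra `1` covers `l + p = 0`.
  have hμ : 0 < τ / (l + p + 1) := by positivity
  obtain ⟨χ, hχ⟩ := P.exists_isCentral hnull h₁ h₁' hμ
  refine ⟨χ, P.mem_strictFeasible.2 ⟨hχ.pos hμ, (P.F_eq_zero_iff.1 hχ.1).1, ?_⟩⟩
  rw [hχ.gap_eq, mul_div_assoc', div_le_iff₀ (by positivity)]
  nlinarith

theorem strictFeasible_subset_feasible (τ : EReal) : P.strictFeasible τ ⊆ P.feasible τ :=
  fun _ h => ⟨h.1.nonneg, h.2⟩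

theorem feasible_nonempty (hnull : P.NullCondition) {χ₁ : PLQVar l p k n} (h₁ : χ₁.Pos)
    (h₁' : P.LinearEqs χ₁) {τ : ℝ} (hτ : 0 ≤ τ) : (P.feasible τ).Nonempty := by
  have hne {ε : ℝ} (hε : 0 < ε) : (P.feasible ε).Nonempty :=
    (P.strictFeasible_nonempty hnull h₁ h₁' hε).mono (P.strictFeasible_subset_feasible ε)
  obtain ⟨χ, hχ, hmin⟩ := (P.isCompact_feasible hnull h₁ h₁' 1).exists_isMinOn (hne one_pos)
    PLQVar.continuous_gap.continuousOn
  obtain ⟨hn, hl, hg⟩ := P.mem_feasible.1 hχ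
  refine ⟨χ, P.mem_feasible.2 ⟨hn, hl, le_trans ?_ hτ⟩⟩
  refine le_of_forall_pos_le_add fun ε hε => ?_
  obtain ⟨χ', hχ'⟩ := hne (lt_min hε one_pos)
  obtain ⟨hn', hl', hg'⟩ := P.mem_feasible.1 hχ'
  have : χ.gap ≤ χ'.gap := hmin (P.mem_feasible.2 ⟨hn', hl', hg'.trans (min_le_right _ _)⟩)
  linarith [hg'.trans (min_le_left _ _)]

/-- Mixing any positive share of a strictly feasible point into a feasible one makes it positive,
and convexity preserves the gap bound. -/
theorem closure_strictFeasible {τ : ℝ} (hne : (P.strictFeasible τ).Nonempty) :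
    closure (P.strictFeasible τ) = P.feasible τ := by
  refine subset_antisymm
    (closure_minimal (P.strictFeasible_subset_feasible τ) (P.isClosed_feasible τ)) ?_
  intro χ hχ
  obtain ⟨χ', hχ'⟩ := hne
  have hlim : Tendsto (fun t : ℝ => (1 - t) • χ + t • χ') (𝓝[>] 0) (𝓝 χ) := by
    have hc : Continuous fun t : ℝ => (1 - t) • χ + t • χ' := by fun_prop
    have := hc.tendsto 0
    simp only [sub_zero, one_smul, zero_smul, add_zero] at this
    exact this.mono_left nhdsWithin_le_nhds
  refine mem_closure_of_tendsto hlim ?_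
  filter_upwards [Ioo_mem_nhdsGT (one_pos : (0 : ℝ) < 1)] with t ht
  have h0 : 0 ≤ 1 - t := by linarith [ht.2]
  refine P.mem_strictFeasible.2 ⟨(P.mem_feasible.1 hχ).1.smul_add_pos
    (P.mem_strictFeasible.1 hχ').1 h0 ht.1, ?_⟩
  exact P.convex_setOf_gap_le τ (P.mem_feasible.1 hχ).2 (P.mem_strictFeasible.1 hχ').2 h0 ht.1.le
    (by ring)

/-! ### Limits of the central path, and sufficiency of the KKT conditions. -/

theorem isKKT_of_mapClusterPt {path : ℝ → PLQVar l p k n}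
    (hpath : ∀ μ : ℝ, 0 < μ → P.IsCentral μ (path μ)) {χ : PLQVar l p k n}
    (hχ : MapClusterPt χ (𝓝[>] (0 : ℝ)) path) : P.IsKKT χ := by
  -- The path eventually lies in each closed set `P.feasible ε`, because its gap is `(l + p) * μ`.
  have hmem {ε : ℝ} (hε : 0 < ε) : χ ∈ P.feasible ε := by
    have hlim : Tendsto (fun μ : ℝ => (l + p) * μ) (𝓝[>] 0) (𝓝 0) := by
      have hc : Continuous fun μ : ℝ => (l + p) * μ := by fun_prop
      have := hc.tendsto 0
      rw [mul_zero] at this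
      exact this.mono_left nhdsWithin_le_nhds
    have hev : ∀ᶠ μ in 𝓝[>] (0 : ℝ), path μ ∈ P.feasible ε := by
      filter_upwards [hlim.eventually_le_const hε, self_mem_nhdsWithin] with μ h₁ h₂
      exact (hpath μ h₂).mem_feasible h₁
    rw [← (P.isClosed_feasible ε).closure_eq, mem_closure_iff_clusterPt]
    exact ClusterPt.mono hχ (le_principal_iff.2 hev)
  obtain ⟨hn, hl, -⟩ := P.mem_feasible.1 (hmem one_pos)
  refine ⟨hl, hn, le_antisymm (le_of_forall_pos_le_add fun ε hε => ?_) hn.gap_nonneg⟩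
  rw [zero_add]
  exact (P.mem_feasible.1 (hmem hε)).2.2

theorem dotProduct_M_comm (x z : Fin k → ℝ) : x ⬝ᵥ P.M *ᵥ z = z ⬝ᵥ P.M *ᵥ x := by
  conv_lhs => rw [← P.isSymm_M, Matrix.mulVec_transpose, dotProduct_comm]
  rw [Matrix.dotProduct_mulVec]

theorem IsKKT.isSolution {P : PLQProblem l p k n} {χ : PLQVar l p k n} (h : P.IsKKT χ) :
    P.IsSolution χ.y := by
  obtain ⟨⟨hs, hr, hM, hB⟩, hn, hg⟩ := h
  have hqs0 : 0 ≤ χ.q ⬝ᵥ χ.s := dotProduct_nonneg_of_nonneg hn.1 hn.2.2.1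
  have hwr0 : 0 ≤ χ.w ⬝ᵥ χ.r := dotProduct_nonneg_of_nonneg hn.2.1 hn.2.2.2
  have hqs : χ.q ⬝ᵥ χ.s = 0 := by unfold PLQVar.gap at hg; linarith
  have hwr : χ.w ⬝ᵥ χ.r = 0 := by unfold PLQVar.gap at hg; linarith
  have hCq : P.b + P.B *ᵥ χ.y = P.M *ᵥ χ.u + P.C *ᵥ χ.q := by
    rw [eq_comm, ← sub_eq_zero, ← hM]; abel
  have hU : χ.u ∈ P.U := fun i => by
    have := hn.2.2.1 i
    rw [hs] at this
    simpa using this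
  have hY : χ.y ∈ P.Y := fun i => by
    have := hn.2.2.2 i
    rw [hr] at this
    simpa using this
  refine ⟨hY, fun y hy => ?_⟩
  -- The supremum at `χ.y` is attained at `χ.u`: the inner problem is concave, and `χ.q` is a
  -- multiplier certifying optimality.
  have upper : P.ρ χ.y ≤ ((χ.u ⬝ᵥ (P.b + P.B *ᵥ χ.y) -
      (1 / 2) * (χ.u ⬝ᵥ (P.M *ᵥ χ.u)) : ℝ) : EReal) := by
    refine iSup₂_le fun u hu => EReal.coe_le_coe_iff.2 ?_
    have hpsd := P.dotProduct_M_nonneg (u - χ.u)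
    rw [Matrix.mulVec_sub, sub_dotProduct, dotProduct_sub, dotProduct_sub,
      P.dotProduct_M_comm χ.u u] at hpsd
    have hq : u ⬝ᵥ P.C *ᵥ χ.q ≤ χ.u ⬝ᵥ P.C *ᵥ χ.q := by
      have e (v : Fin k → ℝ) : v ⬝ᵥ P.C *ᵥ χ.q = χ.q ⬝ᵥ P.Cᵀ *ᵥ v := by
        rw [Matrix.mulVec_transpose, Matrix.dotProduct_mulVec, dotProduct_comm]
      have e' : χ.q ⬝ᵥ P.Cᵀ *ᵥ χ.u = χ.q ⬝ᵥ P.c := by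
        rw [hs, dotProduct_sub] at hqs
        linarith
      rw [e, e, e']
      exact dotProduct_le_dotProduct_of_nonneg_left hu hn.1
    rw [hCq, dotProduct_add, dotProduct_add]
    linarith
  -- Testing `P.ρ y` with the same `χ.u` leaves an inequality affine in `y`, for which `χ.w` is the
  -- multiplier.
  refine upper.trans (le_trans ?_ (le_iSup₂_of_le χ.u hU le_rfl))
  refine EReal.coe_le_coe_iff.2 ?_
  have e (v : Fin n → ℝ) : χ.u ⬝ᵥ P.B *ᵥ v = -(χ.w ⬝ᵥ P.Aᵀ *ᵥ v) := by
    have h₁ : χ.u ⬝ᵥ P.B *ᵥ v = v ⬝ᵥ P.Bᵀ *ᵥ χ.u := by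
      rw [Matrix.mulVec_transpose, Matrix.dotProduct_mulVec, dotProduct_comm]
    have h₂ : χ.w ⬝ᵥ P.Aᵀ *ᵥ v = v ⬝ᵥ P.A *ᵥ χ.w := by
      rw [Matrix.mulVec_transpose, Matrix.dotProduct_mulVec, dotProduct_comm]
    rw [h₁, h₂, eq_neg_of_add_eq_zero_left hB, dotProduct_neg]
  have hw : χ.w ⬝ᵥ P.Aᵀ *ᵥ y ≤ χ.w ⬝ᵥ P.Aᵀ *ᵥ χ.y := by
    have e' : χ.w ⬝ᵥ P.Aᵀ *ᵥ χ.y = χ.w ⬝ᵥ P.a := by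
      rw [hr, dotProduct_sub] at hwr
      linarith
    rw [e']
    exact dotProduct_le_dotProduct_of_nonneg_left hy hn.2.1
  rw [dotProduct_add, dotProduct_add, e, e]
  linarith

end PLQProblem

end

theorem theorem5p4 {l p k n : ℕ} (P : PLQProblem l p k n)
    (hfeas : (P.strictFeasible ⊤).Nonempty) (hnull : P.NullCondition) :
    P.Implementable ∧
    (∀ τ : ℝ, 0 ≤ τ →
      (P.feasible τ).Nonempty ∧ Convex ℝ (P.feasible τ) ∧ IsCompact (P.feasible τ)) ∧
    (∀ τ : ℝ, 0 < τ →
      (P.strictFeasible τ).Nonempty ∧ Convex ℝ (P.strictFeasible τ) ∧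
        closure (P.strictFeasible τ) = P.feasible τ) ∧
    (∀ μ : ℝ, 0 < μ → ∃! χ : PLQVar l p k n, P.IsCentral μ χ) ∧
    (∀ path : ℝ → PLQVar l p k n, (∀ μ : ℝ, 0 < μ → P.IsCentral μ (path μ)) →
      ∀ χ : PLQVar l p k n, MapClusterPt χ (𝓝[>] (0 : ℝ)) path →
        P.IsKKT χ ∧ P.IsSolution χ.y) := by
  obtain ⟨χ₁, h₁, h₁', -⟩ := hfeas
  refine ⟨P.implementable hnull, fun τ hτ => ?_, fun τ hτ => ?_, fun μ hμ => ?_, ?_⟩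
  · exact ⟨P.feasible_nonempty hnull h₁ h₁' hτ, P.convex_feasible τ,
      P.isCompact_feasible hnull h₁ h₁' τ⟩
  · have hne := P.strictFeasible_nonempty hnull h₁ h₁' hτ
    exact ⟨hne, P.convex_strictFeasible τ, P.closure_strictFeasible hne⟩
  · obtain ⟨χ, hχ⟩ := P.exists_isCentral hnull h₁ h₁' hμ
    exact ⟨χ, hχ, fun χ' hχ' => hχ'.eq hnull hμ hχ⟩
  · intro path hpath χ hχ
    have h := P.isKKT_of_mapClusterPt hpath hχ
    exact ⟨h, h.isSolution⟩
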